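/- For a real normed space $X$ let $\mathrm{Lip}_0(X)$ be the Banach space of Lipschitz functions $f:X\to\mathbb R$ with $f(0)=0$, normed by the best Lipschitz constant. The Lipschitz free space $F(X)$ is the closed linear span of the evaluation functionals $\delta_x:f\mapsto f(x)$, $x\in X$, in the dual space $\mathrm{Lip}_0(X)^*$, with the dual norm. Let $\beta_{\mathbb R}:F(\mathbb R)\to\mathbb R$ be the linear contraction with $\beta_{\mathbb R}(\delta_x)=x$ for all $x\in\mathbb R$, and let $\hat\otimes_\pi$ denote the completed projective tensor product of normed spaces; $\ker(\beta_{\mathbb R})$ has the norm of $F(\mathbb R)$. Lebesgue measure is used throughout. **Lemma 5.2.** There are linear isometric isomorphisms $\varphi:F(\mathbb R)\to L^1(\mathbb R)$ and $\Phi:F(\mathbb R)\hat\otimes_\pi F(\mathbb R)\to L^1(\mathbb R^2)$ such that $\varphi(\delta_x)=\chi_{(0,x)}$ for $x>0$, $\varphi(\delta_x)=-\chi_{(x,0)}$ for $x<0$, $\varphi(\delta_0)=0$, and $\Phi(\mu\otimes\nu)(x,y)=\varphi(\mu)(x)\,\varphi(\nu)(y)$ for almost every $(x,y)$, for all $\mu,\nu\in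 F(\mathbb R)$; moreover, the following hold. 1. There is a linear isometric isomorphism $$\Psi_1:\ \ker(\beta_{\mathbb R})\,\hat\otimes_\pi F(\mathbb R)\ \to\ \Big\{f\in L^1(\mathbb R^2):\ \int_{\mathbb R} f(x,y)\,dx=0\ \text{for a.e. } y\Big\}$$ with $\Psi_1(\kappa\otimes\nu)=\Phi(\kappa\otimes\nu)$ for all $\kappa\in\ker(\beta_{\mathbb R})$ and $\nu\in F(\mathbb R)$. Moreover, $\Phi$ maps the closed linear span of $\{\kappa\otimes\nu:\kappa\in\ker(\beta_{\mathbb R}),\ \nu\in F(\mathbb R)\}$ in $F(\mathbb R)\hat\otimes_\pi F(\mathbb R)$ onto this subspace of $L^1(\mathbb R^2)$. 2. There is a linear isometric isomorphism $$\Psi_2:\ F(\mathbb R)\,\hat\otimes_\pi \ker(\beta_{\mathbb R})\ \to\ \Big\{f\in L^1(\mathbb R^2):\ \int_{\mathbb R} f(x,y)\,dy=0\ \text{for a.e. } x\Big\}$$ with $\Psi_2(\mu\otimes\kappa)=\Phi(\mu\otimes\kappa)$ for all $\mu\in F(\mathbb R)$ and $\kappa\in\ker(\beta_{\mathbb R})$.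 Moreover, $\Phi$ maps the closed linear span of $\{\mu\otimes\kappa:\mu\in F(\mathbb R),\ \kappa\in\ker(\beta_{\mathbb R})\}$ in $F(\mathbb R)\hat\otimes_\pi F(\mathbb R)$ onto this subspace of $L^1(\mathbb R^2)$. -/

import Mathlib

open MeasureTheory TensorProduct

noncomputable section

namespace LipFreeTensor

/-! ### The Lipschitz dual of a normed space -/

section Lipschitz

variable (X : Type*) [NormedAddCommGroup X]

/-- The vector space of real Lipschitz functions on `X` that vanish at `0`. -/
def lipZeroSubmodule : Submodule ℝ (X → ℝ) where
  carrier := {f | f 0 = 0 ∧ ∃ C : ℝ, ∀ x y, |f x - f y| ≤ C * ‖x - y‖}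
  zero_mem' := ⟨rfl, 0, fun x y => by simp⟩
  add_mem' := by
    rintro f g ⟨hf0, C, hC⟩ ⟨hg0, D, hD⟩
    refine ⟨by simp [hf0, hg0], C + D, fun x y => ?_⟩
    calc |(f + g) x - (f + g) y| = |(f x - f y) + (g x - g y)| := by
          simp only [Pi.add_apply]; ring_nf
      _ ≤ |f x - f y| + |g x - g y| := abs_add_le _ _
      _ ≤ (C + D) * ‖x - y‖ := by rw [add_mul]; exact add_le_add (hC x y) (hD x y)
  smul_mem' := by
    rintro c f ⟨hf0, C, hC⟩
    refine ⟨by simp [hf0], |c| * C, fun x y => ?_⟩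
    calc |(c • f) x - (c • f) y| = |c| * |f x - f y| := by
          rw [← abs_mul]; simp only [Pi.smul_apply, smul_eq_mul]; ring_nf
      _ ≤ |c| * C * ‖x - y‖ := by
          rw [mul_assoc]; exact mul_le_mul_of_nonneg_left (hC x y) (abs_nonneg c)

/-- The space `Lip₀(X)`, as a type of its own: its topology is the one of the Lipschitz norm,
not the one of pointwise convergence. -/
def LipZero : Type _ := lipZeroSubmodule X

instance : AddCommGroup (LipZero X) := inferInstanceAs (AddCommGroup (lipZeroSubmodule X))

instance : Module ℝ (LipZero X) := inferInstanceAs (Module ℝ (lipZeroSubmodule X))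

variable {X}

/-- The function underlying an element of `Lip₀(X)`. -/
def LipZero.toFun (f : LipZero X) : X → ℝ := f.1

instance : CoeFun (LipZero X) (fun _ => X → ℝ) := ⟨LipZero.toFun⟩

theorem LipZero.ext {f g : LipZero X} (h : ∀ x, f x = g x) : f = g :=
  Subtype.ext (funext h)

theorem LipZero.map_zero (f : LipZero X) : f 0 = 0 := f.2.1

/-- The best Lipschitz constant `sup { |f x - f y| / ‖x - y‖ : x ≠ y }` (the pairs with `x = y`
contribute the value `0`). -/
def lipConst (f : LipZero X) : ℝ := ⨆ p : X × X, |f p.1 - f p.2| / ‖p.1 - p.2‖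

theorem lipConst_nonneg (f : LipZero X) : 0 ≤ lipConst f :=
  Real.iSup_nonneg fun _ => by positivity

theorem lipConst_le {f : LipZero X} {C : ℝ} (hC : 0 ≤ C)
    (h : ∀ x y, |f x - f y| ≤ C * ‖x - y‖) : lipConst f ≤ C :=
  Real.iSup_le (fun p => div_le_of_le_mul₀ (norm_nonneg _) hC (h p.1 p.2)) hC

theorem abs_sub_le_lipConst (f : LipZero X) (x y : X) :
    |f x - f y| ≤ lipConst f * ‖x - y‖ := by
  obtain ⟨C, hC⟩ := f.2.2
  have hb : BddAbove (Set.range fun p : X × X => |f p.1 - f p.2| / ‖p.1 - p.2‖) := by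
    refine ⟨max C 0, ?_⟩
    rintro _ ⟨p, rfl⟩
    refine div_le_of_le_mul₀ (norm_nonneg _) (le_max_right _ _) ((hC p.1 p.2).trans ?_)
    exact mul_le_mul_of_nonneg_right (le_max_left _ _) (norm_nonneg _)
  rcases eq_or_ne x y with rfl | hxy
  · simp
  · have h := le_ciSup hb (x, y)
    exact (div_le_iff₀ (norm_pos_iff.2 (sub_ne_zero.2 hxy))).1 h

/-- The Lipschitz constant is a norm on `Lip₀(X)`. -/
def lipNorm : AddGroupNorm (LipZero X) where
  toFun := lipConst
  map_zero' := le_antisymm (lipConst_le le_rfl fun x y => by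
    change |(0 : ℝ) - 0| ≤ _; simp) (lipConst_nonneg _)
  add_le' f g := lipConst_le (add_nonneg (lipConst_nonneg f) (lipConst_nonneg g)) fun x y => by
    change |(f x + g x) - (f y + g y)| ≤ _
    rw [add_sub_add_comm, add_mul]
    exact (abs_add_le _ _).trans
      (add_le_add (abs_sub_le_lipConst f x y) (abs_sub_le_lipConst g x y))
  neg' f := by
    have key : ∀ g : LipZero X, lipConst (-g) ≤ lipConst g := fun g =>
      lipConst_le (lipConst_nonneg g) fun x y => by
        change |-(g x) - -(g y)| ≤ _
        rw [neg_sub_neg, abs_sub_comm]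
        exact abs_sub_le_lipConst g x y
    exact le_antisymm (key f) (by simpa using key (-f))
  eq_zero_of_map_eq_zero' f hf := LipZero.ext fun x => by
    have h := abs_sub_le_lipConst f x 0
    change lipConst f = 0 at hf
    rw [hf, zero_mul, f.map_zero, sub_zero] at h
    exact abs_nonpos_iff.1 h

instance : NormedAddCommGroup (LipZero X) := lipNorm.toNormedAddCommGroup

theorem LipZero.norm_def (f : LipZero X) : ‖f‖ = lipConst f := rfl

instance : NormedSpace ℝ (LipZero X) where
  norm_smul_le c f := by
    refine lipConst_le (mul_nonneg (norm_nonneg c) (lipConst_nonneg f)) fun x y => ?_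
    change |c * f x - c * f y| ≤ _
    rw [← mul_sub, abs_mul, mul_assoc]
    exact mul_le_mul_of_nonneg_left (abs_sub_le_lipConst f x y) (abs_nonneg c)

/-! ### The Lipschitz free space -/

/-- The evaluation functional `f ↦ f x` on `Lip₀(X)`. -/
def evalDual (x : X) : StrongDual ℝ (LipZero X) :=
  LinearMap.mkContinuous
    { toFun := fun f => f x
      map_add' := fun _ _ => rfl
      map_smul' := fun _ _ => rfl } ‖x‖ fun f => by
    have h := abs_sub_le_lipConst f x 0
    rw [f.map_zero, sub_zero, sub_zero, mul_comm] at h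
    exact h

variable (X) in
/-- The Lipschitz free space `F(X)`: the closed linear span of the evaluation functionals in the
dual of `Lip₀(X)`, with the dual norm. -/
def lipFreeSubmodule : Submodule ℝ (StrongDual ℝ (LipZero X)) :=
  (Submodule.span ℝ (Set.range (evalDual (X := X)))).topologicalClosure

variable (X) in
/-- The Lipschitz free space `F(X)` as a normed space. -/
def LipFree : Type _ := lipFreeSubmodule X

instance : NormedAddCommGroup (LipFree X) :=
  inferInstanceAs (NormedAddCommGroup (lipFreeSubmodule X))

instance : NormedSpace ℝ (LipFree X) := inferInstanceAs (NormedSpace ℝ (lipFreeSubmodule X))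

variable (X) in
/-- The isometric inclusion of `F(X)` in the dual of `Lip₀(X)`. -/
def LipFree.incl : LipFree X →L[ℝ] StrongDual ℝ (LipZero X) := (lipFreeSubmodule X).subtypeL

/-- The canonical map `δ : X → F(X)`. -/
def delta (x : X) : LipFree X :=
  ⟨evalDual x, Submodule.le_topologicalClosure _ (Submodule.subset_span ⟨x, rfl⟩)⟩

end Lipschitz

/-- The identity of `ℝ` as an element of `Lip₀(ℝ)`. -/
def lipId : LipZero ℝ := ⟨id, rfl, 1, fun x y => by simp⟩

/-- The linear contraction `β : F(ℝ) → ℝ` with `β (δ x) = x` for all `x`. -/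
def beta : LipFree ℝ →L[ℝ] ℝ :=
  (ContinuousLinearMap.apply ℝ ℝ lipId).comp (LipFree.incl ℝ)

theorem beta_delta (x : ℝ) : beta (delta x) = x := rfl

theorem norm_beta_le : ‖beta‖ ≤ 1 := by
  refine ContinuousLinearMap.opNorm_le_bound _ zero_le_one fun μ => ?_
  have h1 : ‖lipId‖ ≤ 1 := lipConst_le zero_le_one fun x y => by
    change |x - y| ≤ 1 * ‖x - y‖
    rw [one_mul, Real.norm_eq_abs]
  calc ‖beta μ‖ ≤ ‖LipFree.incl ℝ μ‖ * ‖lipId‖ :=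
        (LipFree.incl ℝ μ).le_opNorm lipId
    _ ≤ 1 * ‖μ‖ := by
        rw [mul_comm]; exact mul_le_mul_of_nonneg_right h1 (norm_nonneg _)

/-! ### The completed projective tensor product of two normed spaces -/

section Projective

variable (E G : Type*) [NormedAddCommGroup E] [NormedSpace ℝ E]
  [NormedAddCommGroup G] [NormedSpace ℝ G]

variable {E G} in
/-- The values `∑ ‖aᵢ‖ ‖bᵢ‖` over all the representations `u = ∑ aᵢ ⊗ bᵢ`. -/
def projCosts (u : E ⊗[ℝ] G) : Set ℝ :=
  {r | ∃ l : List (E × G), u = (l.map fun p => p.1 ⊗ₜ[ℝ] p.2).sum ∧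
    r = (l.map fun p => ‖p.1‖ * ‖p.2‖).sum}

variable {E G} in
theorem projCosts_nonneg {u : E ⊗[ℝ] G} {r : ℝ} (hr : r ∈ projCosts u) : 0 ≤ r := by
  obtain ⟨l, -, rfl⟩ := hr
  refine List.sum_nonneg fun x hx => ?_
  obtain ⟨p, -, rfl⟩ := List.mem_map.1 hx
  positivity

variable {E G} in
theorem projCosts_bddBelow (u : E ⊗[ℝ] G) : BddBelow (projCosts u) :=
  ⟨0, fun _ hr => projCosts_nonneg hr⟩

variable {E G} in
theorem projCosts_add {u v : E ⊗[ℝ] G} {r s : ℝ} (hr : r ∈ projCosts u)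
    (hs : s ∈ projCosts v) : r + s ∈ projCosts (u + v) := by
  obtain ⟨l, rfl, rfl⟩ := hr
  obtain ⟨m, rfl, rfl⟩ := hs
  exact ⟨l ++ m, by simp, by simp⟩

variable {E G} in
theorem projCosts_smul (c : ℝ) {u : E ⊗[ℝ] G} {r : ℝ} (hr : r ∈ projCosts u) :
    |c| * r ∈ projCosts (c • u) := by
  obtain ⟨l, rfl, rfl⟩ := hr
  refine ⟨l.map fun p => (c • p.1, p.2), ?_, ?_⟩
  · induction l with
    | nil => simp
    | cons p l ih =>
      simp only [List.map_cons, List.sum_cons, smul_add, TensorProduct.smul_tmul'] at ih ⊢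
      rw [ih]
  · induction l with
    | nil => simp
    | cons p l ih =>
      simp only [List.map_cons, List.sum_cons, mul_add, norm_smul, Real.norm_eq_abs] at ih ⊢
      rw [ih, mul_assoc]

variable {E G} in
theorem projCosts_nonempty (u : E ⊗[ℝ] G) : (projCosts u).Nonempty := by
  induction u using TensorProduct.induction_on with
  | zero => exact ⟨0, [], by simp, by simp⟩
  | tmul a b => exact ⟨‖a‖ * ‖b‖, [(a, b)], by simp, by simp⟩
  | add u v hu hv =>
    obtain ⟨r, hr⟩ := hu
    obtain ⟨s, hs⟩ := hv
    exact ⟨r + s, projCosts_add hr hs⟩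

/-- The projective norm `π(u) = inf { ∑ ‖aᵢ‖ ‖bᵢ‖ : u = ∑ aᵢ ⊗ bᵢ }`. -/
def projSeminorm : Seminorm ℝ (E ⊗[ℝ] G) :=
  Seminorm.ofSMulLE (fun u => sInf (projCosts u))
    (le_antisymm (csInf_le (projCosts_bddBelow _) ⟨[], by simp, by simp⟩)
      (le_csInf (projCosts_nonempty _) fun _ hr => projCosts_nonneg hr))
    (fun u v => by
      refine le_of_forall_pos_le_add fun ε hε => ?_
      obtain ⟨r, hr, hr'⟩ := Real.lt_sInf_add_pos (projCosts_nonempty u) (half_pos hε)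
      obtain ⟨s, hs, hs'⟩ := Real.lt_sInf_add_pos (projCosts_nonempty v) (half_pos hε)
      have := csInf_le (projCosts_bddBelow _) (projCosts_add hr hs)
      linarith)
    (fun c u => by
      rcases (norm_nonneg c).eq_or_lt with h0 | hc
      · rw [← h0, zero_mul, norm_eq_zero.1 h0.symm, zero_smul]
        exact csInf_le (projCosts_bddBelow _) ⟨[], by simp, by simp⟩
      · rw [mul_comm, ← div_le_iff₀ hc]
        refine le_csInf (projCosts_nonempty u) fun r hr => ?_
        rw [div_le_iff₀ hc, mul_comm]
        exact csInf_le (projCosts_bddBelow _) (projCosts_smul c hr))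

/-- The algebraic tensor product `E ⊗ G`, as a type that carries the projective norm. -/
def AlgProjTensor : Type _ := E ⊗[ℝ] G

instance : AddCommGroup (AlgProjTensor E G) := inferInstanceAs (AddCommGroup (E ⊗[ℝ] G))

instance : Module ℝ (AlgProjTensor E G) := inferInstanceAs (Module ℝ (E ⊗[ℝ] G))

instance : SeminormedAddCommGroup (AlgProjTensor E G) :=
  (show AddGroupSeminorm (AlgProjTensor E G) from
    (projSeminorm E G).toAddGroupSeminorm).toSeminormedAddCommGroup

instance : NormedSpace ℝ (AlgProjTensor E G) where
  norm_smul_le c u := (map_smul_eq_mul (projSeminorm E G) c u).le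

variable {E G} in
theorem AlgProjTensor.norm_def (u : AlgProjTensor E G) : ‖u‖ = sInf (projCosts (E := E) (G := G) u) :=
  rfl

/-- The completed projective tensor product of `E` and `G`. -/
abbrev ProjTensor : Type _ := UniformSpace.Completion (AlgProjTensor E G)

variable {E G}

/-- The elementary tensor `a ⊗ b` in the algebraic tensor product with the projective norm. -/
def algTmul (a : E) (b : G) : AlgProjTensor E G := a ⊗ₜ[ℝ] b

/-- The elementary tensor `a ⊗ b` in the completed projective tensor product. -/
def ptmul (a : E) (b : G) : ProjTensor E G := (algTmul a b : ProjTensor E G)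

/-- For subspaces `A` of `E` and `B` of `G`, the closed linear span in the completed projective
tensor product of `E` and `G` of the elementary tensors `a ⊗ b` with `a ∈ A` and `b ∈ B`. -/
def closedSpanTensors (A : Submodule ℝ E) (B : Submodule ℝ G) : Submodule ℝ (ProjTensor E G) :=
  (Submodule.span ℝ {ξ | ∃ a ∈ A, ∃ b ∈ B, ξ = ptmul a b}).topologicalClosure

end Projective

/-! ### The subspaces of `L¹(ℝ²)` -/

/-- The Banach space `L¹(ℝ)`. -/
abbrev L1Line : Type := Lp ℝ 1 (volume : Measure ℝ)

/-- The Banach space `L¹(ℝ²)`. -/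
abbrev L1Plane : Type := Lp ℝ 1 (volume : Measure (ℝ × ℝ))

/-- The functions `f` in `L¹(ℝ²)` with `∫ f(x, y) dx = 0` for almost every `y`. For `f` in
`L¹(ℝ²)` almost every section is integrable. -/
def zeroFstIntegral : Submodule ℝ L1Plane where
  carrier := {f | ∀ᵐ y : ℝ, ∫ x : ℝ, f (x, y) = 0}
  zero_mem' := by
    have h : ∀ᵐ p : ℝ × ℝ, (0 : L1Plane) p = 0 := Lp.coeFn_zero ℝ 1 volume
    have h' : ∀ᵐ y : ℝ, ∀ᵐ x : ℝ, (0 : L1Plane) (x, y) = 0 :=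
      Measure.ae_ae_of_ae_prod (Measure.measurePreserving_swap.quasiMeasurePreserving.ae h)
    filter_upwards [h'] with y hy
    rw [integral_congr_ae (g := fun _ => (0 : ℝ)) hy, integral_zero]
  add_mem' := by
    intro f g hf hg
    have h : ∀ᵐ p : ℝ × ℝ, (f + g) p = f p + g p := Lp.coeFn_add f g
    have h' : ∀ᵐ y : ℝ, ∀ᵐ x : ℝ, (f + g) (x, y) = f (x, y) + g (x, y) :=
      Measure.ae_ae_of_ae_prod (Measure.measurePreserving_swap.quasiMeasurePreserving.ae h)
    filter_upwards [h', hf, hg, (L1.integrable_coeFn f).prod_left_ae,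
      (L1.integrable_coeFn g).prod_left_ae] with y hy hf hg hfi hgi
    rw [integral_congr_ae (g := fun x => f (x, y) + g (x, y)) hy, integral_add hfi hgi, hf, hg,
      add_zero]
  smul_mem' := by
    intro c f hf
    have h : ∀ᵐ p : ℝ × ℝ, (c • f) p = c * f p := Lp.coeFn_smul c f
    have h' : ∀ᵐ y : ℝ, ∀ᵐ x : ℝ, (c • f) (x, y) = c * f (x, y) :=
      Measure.ae_ae_of_ae_prod (Measure.measurePreserving_swap.quasiMeasurePreserving.ae h)
    change ∀ᵐ y : ℝ, ∫ x : ℝ, (c • f) (x, y) = 0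
    filter_upwards [h', hf] with y hy hf
    rw [integral_congr_ae (g := fun x => c * f (x, y)) hy, integral_const_mul, hf, mul_zero]

/-- The functions `f` in `L¹(ℝ²)` with `∫ f(x, y) dy = 0` for almost every `x`. -/
def zeroSndIntegral : Submodule ℝ L1Plane where
  carrier := {f | ∀ᵐ x : ℝ, ∫ y : ℝ, f (x, y) = 0}
  zero_mem' := by
    have h : ∀ᵐ p : ℝ × ℝ, (0 : L1Plane) p = 0 := Lp.coeFn_zero ℝ 1 volume
    filter_upwards [Measure.ae_ae_of_ae_prod h] with x hx
    rw [integral_congr_ae (g := fun _ => (0 : ℝ)) hx, integral_zero]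
  add_mem' := by
    intro f g hf hg
    have h : ∀ᵐ p : ℝ × ℝ, (f + g) p = f p + g p := Lp.coeFn_add f g
    filter_upwards [Measure.ae_ae_of_ae_prod h, hf, hg, (L1.integrable_coeFn f).prod_right_ae,
      (L1.integrable_coeFn g).prod_right_ae] with x hx hf hg hfi hgi
    rw [integral_congr_ae (g := fun y => f (x, y) + g (x, y)) hx, integral_add hfi hgi, hf, hg,
      add_zero]
  smul_mem' := by
    intro c f hf
    have h : ∀ᵐ p : ℝ × ℝ, (c • f) p = c * f p := Lp.coeFn_smul c f
    change ∀ᵐ x : ℝ, ∫ y : ℝ, (c • f) (x, y) = 0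
    filter_upwards [Measure.ae_ae_of_ae_prod h, hf] with x hx hf
    rw [integral_congr_ae (g := fun y => c * f (x, y)) hx, integral_const_mul, hf, mul_zero]

/-- The kernel of `β`, a closed subspace of `F(ℝ)`. -/
abbrev kerBeta : Submodule ℝ (LipFree ℝ) := LinearMap.ker (beta : LipFree ℝ →ₗ[ℝ] ℝ)

end LipFreeTensor

end

/-!
The derivative identifies `Lip₀(ℝ)` with `L^∞(ℝ)`, the dual of `L¹(ℝ)`. Concretely, `g ∈ L¹(ℝ)`
acts on `f ∈ Lip₀(ℝ)` by `∫ g f'`. Testing against the primitive of the sign of `g` shows that this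
is an isometry of `L¹(ℝ)` into the dual of `Lip₀(ℝ)` (`norm_derivPairing`); by the fundamental
theorem of calculus for Lipschitz functions it takes the signed indicator function of the interval
between `0` and `x` to the evaluation at `x`, and these functions span a dense subspace of `L¹(ℝ)`,
so its range is `F(ℝ)` (`range_derivIsometry`). The isomorphism `φ` is its inverse. Since
`β` is the evaluation at the function `x ↦ x`, of derivative `1`, it becomes integration, and
`ker β` becomes the space of the integrable functions of integral `0`.

If `E` is isometric to any subspace of `L¹(ℝ)`, then `a ⊗ b ↦ a(x) b(y)` is an isometry of the
projective tensor product of `E` and `L¹(ℝ)` into `L¹(ℝ²)` (`norm_algLift_mulProdOf`). The point is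
that a tensor `∑ aᵢ ⊗ χᵢ` with indicator functions `χᵢ` of disjoint sets has norm
`∑ ‖aᵢ‖ ‖χᵢ‖` in `L¹(ℝ²)`, and this is one of the costs of which the projective norm is the infimum;
such tensors are dense. No property of the subspace is needed, which is why the same lemma serves
`F(ℝ)` and `ker β`, the latter with its own projective norm.

The range of such an isometry is the closed linear span of the products `a(x) b(y)`. For `E = L¹(ℝ)`
this is all of `L¹(ℝ²)`, by density of the rectangles (`closure_span_mulProd`). For the functions
`a` of integral `0` it is the kernel of the marginal `F ↦ ∫ F(x, y) dx`: the projection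
`F ↦ F - h(x) ∫ F(x', y) dx'` onto this kernel, with `∫ h = 1`, sends products to products of the
right kind (`zeroFstIntegral_eq_closure`). The statements about the other variable follow by
exchanging the coordinates.
-/

noncomputable section

namespace LipFreeTensor

/-! ### Density in `L¹` -/

section Density

variable {α : Type*} [m : MeasurableSpace α] {μ : Measure α}

/-- `W` contains the class of the indicator function of `s`. -/
def ContainsIndicator (W : Submodule ℝ (Lp ℝ 1 μ)) (s : Set α) : Prop :=
  ∃ g ∈ W, g =ᵐ[μ] s.indicator (fun _ => (1 : ℝ))

theorem ContainsIndicator.indicatorConstLp_mem {W : Submodule ℝ (Lp ℝ 1 μ)} {s : Set α}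
    (h : ContainsIndicator W s) (hs : MeasurableSet s) (hμs : μ s ≠ ⊤) (c : ℝ) :
    indicatorConstLp 1 hs hμs c ∈ W := by
  obtain ⟨g, hg, hgs⟩ := h
  convert W.smul_mem c hg using 1
  refine Lp.ext ?_
  filter_upwards [Lp.coeFn_smul c g, hgs, indicatorConstLp_coeFn (p := 1) (hs := hs)
    (hμs := hμs) (c := c)] with x h1 h2 h3
  rw [h3, h1, Pi.smul_apply, h2]
  by_cases hx : x ∈ s <;> simp [hx]

/-- Closed subspaces of `L¹` are stable under increasing unions of the sets whose indicator
functions they contain, as long as the union has finite measure. -/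
theorem ContainsIndicator.iUnion {W : Submodule ℝ (Lp ℝ 1 μ)} (hW : IsClosed (W : Set (Lp ℝ 1 μ)))
    {t : ℕ → Set α} (h : ∀ n, ContainsIndicator W (t n)) (ht : ∀ n, MeasurableSet (t n))
    (hmono : Monotone t) (hμ : μ (⋃ n, t n) ≠ ⊤) : ContainsIndicator W (⋃ n, t n) := by
  have hU : MeasurableSet (⋃ n, t n) := MeasurableSet.iUnion ht
  have hμt : ∀ n, μ (t n) ≠ ⊤ := fun n => measure_ne_top_of_subset (Set.subset_iUnion t n) hμ
  refine ⟨indicatorConstLp 1 hU hμ 1, ?_, indicatorConstLp_coeFn⟩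
  refine hW.mem_of_tendsto (b := Filter.atTop)
    (f := fun n => indicatorConstLp 1 (ht n) (hμt n) (1 : ℝ))
    (tendsto_indicatorConstLp_set ENNReal.one_ne_top ?_)
    (Filter.Eventually.of_forall fun n => (h n).indicatorConstLp_mem _ _ _)
  have h1 : ∀ n, symmDiff (t n) (⋃ n, t n) = (⋃ n, t n) \ t n := fun n => by
    rw [symmDiff_def, sdiff_eq_bot_iff.2 (Set.subset_iUnion t n), bot_sup_eq]
  simp_rw [h1]
  have h2 : ⋂ n, ((⋃ n, t n) \ t n) = ∅ := by
    rw [← Set.sdiff_iUnion, Set.sdiff_self]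
  have h3 := tendsto_measure_iInter_atTop (μ := μ) (s := fun n => (⋃ n, t n) \ t n)
    (fun n => (hU.diff (ht n)).nullMeasurableSet)
    (fun a b hab => Set.sdiff_subset_sdiff_right (hmono hab))
    ⟨0, measure_ne_top_of_subset Set.sdiff_subset hμ⟩
  rwa [h2, measure_empty] at h3

/-- A closed subspace of `L¹` is everything as soon as it contains the indicator functions of the
sets of finite measure of a π-system which generates the σ-algebra and exhausts the space. -/
theorem eq_top_of_containsIndicator {W : Submodule ℝ (Lp ℝ 1 μ)}
    (hW : IsClosed (W : Set (Lp ℝ 1 μ))) {C : Set (Set α)}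
    (hgen : m = MeasurableSpace.generateFrom C) (hC : IsPiSystem C) {K : ℕ → Set α}
    (hK : ∀ n, K n ∈ C) (hμK : ∀ n, μ (K n) ≠ ⊤) (hmono : Monotone K)
    (hcover : ⋃ n, K n = Set.univ)
    (hind : ∀ s ∈ C, μ s ≠ ⊤ → ContainsIndicator W s) : W = ⊤ := by
  have hKm : ∀ n, MeasurableSet (K n) := fun n => by
    rw [hgen]; exact MeasurableSpace.measurableSet_generateFrom (hK n)
  have hempty : ContainsIndicator W ∅ := ⟨0, W.zero_mem, by
    filter_upwards [Lp.coeFn_zero ℝ 1 μ] with x hx; rw [hx, Set.indicator_empty]; rfl⟩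
  have hfin : ∀ n s, μ (s ∩ K n) ≠ ⊤ := fun n s =>
    measure_ne_top_of_subset Set.inter_subset_right (hμK n)
  -- inside the sets `K n`, of finite measure, complements make sense: this is the π-λ theorem
  have key : ∀ n s, MeasurableSet s → ContainsIndicator W (s ∩ K n) := by
    intro n s hs
    induction s, hs using MeasurableSpace.induction_on_inter hgen hC with
    | empty => rwa [Set.empty_inter]
    | basic t ht =>
      rcases (t ∩ K n).eq_empty_or_nonempty with h | h
      · rwa [h]
      · exact hind _ (hC t ht _ (hK n) h) (hfin n t)
    | compl t ht ih =>
      obtain ⟨g, hg, hgt⟩ := ih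
      obtain ⟨k, hk, hkt⟩ := hind _ (hK n) (hμK n)
      refine ⟨k - g, W.sub_mem hk hg, ?_⟩
      filter_upwards [Lp.coeFn_sub k g, hgt, hkt] with x h1 h2 h3
      rw [h1, Pi.sub_apply, h2, h3]
      by_cases hx : x ∈ t <;> by_cases hx' : x ∈ K n <;> simp [hx, hx']
    | iUnion f hf hfm ih =>
      have hacc : ∀ i, MeasurableSet (Set.accumulate f i) := fun i => by
        rw [Set.accumulate_def]
        exact MeasurableSet.biUnion (Set.to_countable _) fun j _ => hfm j
      rw [← Set.iUnion_accumulate, Set.iUnion_inter]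
      refine ContainsIndicator.iUnion hW (fun i => ?_) (fun i => (hacc i).inter (hKm n))
        (fun a b hab => Set.inter_subset_inter_left _ (Set.monotone_accumulate hab)) ?_
      · induction i with
        | zero => simpa using ih 0
        | succ i hi =>
          obtain ⟨g, hg, hgt⟩ := hi
          obtain ⟨k, hk, hkt⟩ := ih (i + 1)
          refine ⟨g + k, W.add_mem hg hk, ?_⟩
          have hd := Set.disjoint_accumulate hf (Nat.lt_succ_self i)
          filter_upwards [Lp.coeFn_add g k, hgt, hkt] with x h1 h2 h3
          rw [h1, Pi.add_apply, h2, h3, Set.accumulate_succ, Set.union_inter_distrib_right,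
            Set.indicator_union_of_disjoint
              (hd.mono Set.inter_subset_left Set.inter_subset_left)]
      · rw [← Set.iUnion_inter]; exact hfin n _
  refine Submodule.eq_top_iff'.2 fun f => ?_
  refine Lp.induction ENNReal.one_ne_top (motive := fun f => f ∈ W) (fun c s hs hμs => ?_)
    (fun f g hf hg _ h1 h2 => W.add_mem h1 h2) hW f
  refine ContainsIndicator.indicatorConstLp_mem ?_ hs hμs.ne c
  have hs' : ⋃ n, s ∩ K n = s := by rw [← Set.inter_iUnion, hcover, Set.inter_univ]
  rw [← hs']
  exact ContainsIndicator.iUnion hW (fun n => key n s hs) (fun n => hs.inter (hKm n))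
    (fun a b hab => Set.inter_subset_inter_right _ (hmono hab)) (by rw [hs']; exact hμs.ne)

end Density

/-! ### Products of integrable functions -/

theorem integrable_mul_prod (f g : L1Line) :
    Integrable (fun p : ℝ × ℝ => f p.1 * g p.2) volume :=
  (L1.integrable_coeFn f).mul_prod (L1.integrable_coeFn g)

/-- An almost everywhere property of the first coordinate holds almost everywhere. -/
theorem ae_fst {P : ℝ → Prop} (h : ∀ᵐ x, P x) : ∀ᵐ p : ℝ × ℝ, P p.1 :=
  Measure.quasiMeasurePreserving_fst.ae h

theorem ae_snd {P : ℝ → Prop} (h : ∀ᵐ x, P x) : ∀ᵐ p : ℝ × ℝ, P p.2 :=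
  Measure.quasiMeasurePreserving_snd.ae h

theorem L1Plane_norm (F : L1Plane) : ‖F‖ = ∫ p, ‖F p‖ := L1.norm_eq_integral_norm F

/-- The bilinear map `(f, g) ↦ f(x) g(y)` from `L¹(ℝ) × L¹(ℝ)` to `L¹(ℝ²)`. -/
def mulProd : L1Line →L[ℝ] L1Line →L[ℝ] L1Plane :=
  LinearMap.mkContinuous₂
    (LinearMap.mk₂ ℝ (fun f g => (integrable_mul_prod f g).toL1 _)
      (fun f f' g => by
        rw [← Integrable.toL1_add]
        refine (Integrable.toL1_eq_toL1_iff _ _ _ _).2 ?_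
        filter_upwards [ae_fst (Lp.coeFn_add f f')] with p hp
        simp only [hp, Pi.add_apply]; ring)
      (fun c f g => by
        rw [← Integrable.toL1_smul']
        refine (Integrable.toL1_eq_toL1_iff _ _ _ _).2 ?_
        filter_upwards [ae_fst (Lp.coeFn_smul c f)] with p hp
        simp only [hp, Pi.smul_apply, smul_eq_mul]; ring)
      (fun f g g' => by
        rw [← Integrable.toL1_add]
        refine (Integrable.toL1_eq_toL1_iff _ _ _ _).2 ?_
        filter_upwards [ae_snd (Lp.coeFn_add g g')] with p hp
        simp only [hp, Pi.add_apply]; ring)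
      (fun c f g => by
        rw [← Integrable.toL1_smul']
        refine (Integrable.toL1_eq_toL1_iff _ _ _ _).2 ?_
        filter_upwards [ae_snd (Lp.coeFn_smul c g)] with p hp
        simp only [hp, Pi.smul_apply, smul_eq_mul]; ring)) 1 (fun f g => by
    rw [one_mul, LinearMap.mk₂_apply, L1.norm_eq_integral_norm f, L1.norm_eq_integral_norm g,
      ← integral_prod_mul, L1Plane_norm]
    refine (integral_congr_ae ?_).le
    filter_upwards [Integrable.coeFn_toL1 (integrable_mul_prod f g)] with p hp
    rw [hp, norm_mul])

theorem coeFn_mulProd (f g : L1Line) : ∀ᵐ p : ℝ × ℝ, mulProd f g p = f p.1 * g p.2 :=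
  Integrable.coeFn_toL1 (integrable_mul_prod f g)

theorem norm_mulProd (f g : L1Line) : ‖mulProd f g‖ = ‖f‖ * ‖g‖ := by
  rw [L1.norm_eq_integral_norm f, L1.norm_eq_integral_norm g, ← integral_prod_mul, L1Plane_norm]
  refine integral_congr_ae ?_
  filter_upwards [coeFn_mulProd f g] with p hp
  rw [hp, norm_mul]

/-- `L¹(ℝ²)` is the closed linear span of the products `f(x) g(y)`. -/
theorem closure_span_mulProd :
    (Submodule.span ℝ {F | ∃ f g, F = mulProd f g}).topologicalClosure = ⊤ := by
  refine eq_top_of_containsIndicator (Submodule.isClosed_topologicalClosure _)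
    generateFrom_prod.symm isPiSystem_prod
    (K := fun n : ℕ => Metric.closedBall 0 n ×ˢ Metric.closedBall 0 n) (fun n =>
      Set.mem_image2_of_mem (measurableSet_closedBall (x := (0 : ℝ)) (ε := n))
        (measurableSet_closedBall (x := (0 : ℝ)) (ε := n)))
    (fun n => ?_) (fun a b hab => ?_) ?_ ?_
  · exact ((isCompact_closedBall 0 _).prod (isCompact_closedBall 0 _)).measure_ne_top
  · have := Metric.closedBall_subset_closedBall (x := (0 : ℝ)) (Nat.cast_le (α := ℝ).2 hab)
    exact Set.prod_mono this this
  · refine Set.eq_univ_of_forall fun p => ?_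
    obtain ⟨n, hn⟩ := exists_nat_ge (max ‖p.1‖ ‖p.2‖)
    refine Set.mem_iUnion.2 ⟨n, ?_, ?_⟩
    · simpa using (le_max_left _ _).trans hn
    · simpa using (le_max_right _ _).trans hn
  · rintro _ ⟨s, hs, t, ht, rfl⟩ hst
    rw [Set.mem_ofPred_eq] at hs ht
    have hcases : (volume s ≠ ⊤ ∧ volume t ≠ ⊤) ∨ volume (s ×ˢ t) = 0 := by
      -- a null factor may have a partner of infinite measure, so this case is apart
      rw [Measure.volume_eq_prod, Measure.prod_prod] at hst ⊢
      rw [Ne, ENNReal.mul_eq_top] at hst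
      rw [mul_eq_zero]
      tauto
    rcases hcases with ⟨h1, h2⟩ | h0
    · refine ⟨mulProd (indicatorConstLp 1 hs h1 1) (indicatorConstLp 1 ht h2 1),
        Submodule.le_topologicalClosure _ (Submodule.subset_span ⟨_, _, rfl⟩), ?_⟩
      filter_upwards [coeFn_mulProd (indicatorConstLp 1 hs h1 1) (indicatorConstLp 1 ht h2 1),
        ae_fst (indicatorConstLp_coeFn (p := 1) (hs := hs) (hμs := h1) (c := (1 : ℝ))),
        ae_snd (indicatorConstLp_coeFn (p := 1) (hs := ht) (hμs := h2) (c := (1 : ℝ)))]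
        with p hp hp1 hp2
      rw [hp, hp1, hp2]
      by_cases h1 : p.1 ∈ s <;> by_cases h2 : p.2 ∈ t <;> simp [Set.indicator, h1, h2]
    · refine ⟨0, Submodule.zero_mem _, ?_⟩
      filter_upwards [Lp.coeFn_zero ℝ 1 (volume : Measure (ℝ × ℝ)),
        measure_eq_zero_iff_ae_notMem.1 h0] with p hp hp'
      rw [hp, Set.indicator_of_notMem hp']; rfl

/-! ### The functions with vanishing marginals -/

/-- Almost every section parallel to the first axis inherits an almost everywhere property. -/
theorem ae_ae_fst {P : ℝ × ℝ → Prop} (h : ∀ᵐ p, P p) : ∀ᵐ y : ℝ, ∀ᵐ x : ℝ, P (x, y) :=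
  Measure.ae_ae_of_ae_prod (Measure.measurePreserving_swap.quasiMeasurePreserving.ae h)

theorem integrable_integral_fst (F : L1Plane) : Integrable (fun y : ℝ => ∫ x : ℝ, F (x, y)) :=
  (L1.integrable_coeFn F).integral_prod_right

/-- The marginal `F ↦ ∫ F(x, y) dx` from `L¹(ℝ²)` to `L¹(ℝ)`. -/
def fstMarginal : L1Plane →L[ℝ] L1Line :=
  LinearMap.mkContinuous
    { toFun := fun F => (integrable_integral_fst F).toL1 _
      map_add' := fun F G => by
        rw [← Integrable.toL1_add]
        refine (Integrable.toL1_eq_toL1_iff _ _ _ _).2 ?_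
        filter_upwards [ae_ae_fst (Lp.coeFn_add F G), (L1.integrable_coeFn F).prod_left_ae,
          (L1.integrable_coeFn G).prod_left_ae] with y h hF hG
        rw [integral_congr_ae h, Pi.add_apply]
        exact integral_add hF hG
      map_smul' := fun c F => by
        rw [RingHom.id_apply, ← Integrable.toL1_smul']
        refine (Integrable.toL1_eq_toL1_iff _ _ _ _).2 ?_
        filter_upwards [ae_ae_fst (Lp.coeFn_smul c F)] with y h
        rw [integral_congr_ae h, Pi.smul_apply]
        exact integral_smul c _ } 1 fun F => by
    have hF := L1.integrable_coeFn F
    rw [one_mul, L1.norm_eq_integral_norm F, L1.norm_eq_integral_norm]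
    calc ∫ y, ‖(integrable_integral_fst F).toL1 _ y‖ = ∫ y, ‖∫ x, F (x, y)‖ := by
          refine integral_congr_ae ?_
          filter_upwards [Integrable.coeFn_toL1 (integrable_integral_fst F)] with y hy
          rw [hy]
      _ ≤ ∫ y, ∫ x, ‖F (x, y)‖ :=
          integral_mono (integrable_integral_fst F).norm hF.norm.integral_prod_right
            fun y => norm_integral_le_integral_norm _
      _ = ∫ p, ‖F p‖ := (integral_prod_symm _ hF.norm).symm

theorem coeFn_fstMarginal (F : L1Plane) : ∀ᵐ y : ℝ, fstMarginal F y = ∫ x : ℝ, F (x, y) :=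
  Integrable.coeFn_toL1 (integrable_integral_fst F)

theorem mem_zeroFstIntegral_iff (F : L1Plane) : F ∈ zeroFstIntegral ↔ fstMarginal F = 0 := by
  change (∀ᵐ y : ℝ, ∫ x : ℝ, F (x, y) = 0) ↔ _
  rw [Lp.eq_zero_iff_ae_eq_zero]
  constructor <;> intro h
  · filter_upwards [h, coeFn_fstMarginal F] with y h1 h2
    rw [h2, h1]; rfl
  · filter_upwards [h, coeFn_fstMarginal F] with y h1 h2
    rw [← h2, h1]; rfl

theorem isClosed_zeroFstIntegral : IsClosed (zeroFstIntegral : Set L1Plane) := by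
  have : (zeroFstIntegral : Set L1Plane) = fstMarginal ⁻¹' {0} :=
    Set.ext fun F => mem_zeroFstIntegral_iff F
  rw [this]
  exact isClosed_singleton.preimage fstMarginal.continuous

theorem fstMarginal_mulProd (f g : L1Line) : fstMarginal (mulProd f g) = (∫ x, f x) • g := by
  refine Lp.ext ?_
  filter_upwards [coeFn_fstMarginal (mulProd f g), ae_ae_fst (coeFn_mulProd f g),
    Lp.coeFn_smul (∫ x, f x) g] with y h1 h2 h3
  rw [h1, integral_congr_ae h2, h3, integral_mul_const]
  rfl

/-- The functions whose first marginal vanishes are the closed linear span of the products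
`f(x) g(y)` with `∫ f = 0`. With `h` of integral `1`, the map
`F ↦ F - h(x) ∫ F(x', y) dx'` is a continuous projection onto this space, and it sends the
products to such products. -/
theorem zeroFstIntegral_eq_closure :
    zeroFstIntegral =
      (Submodule.span ℝ {F | ∃ f g, ∫ x, f x = 0 ∧ F = mulProd f g}).topologicalClosure := by
  refine le_antisymm (fun F hF => ?_) ?_
  · have hvol : volume (Set.Ioo (0 : ℝ) 1) ≠ ⊤ := measure_Ioo_lt_top.ne
    set h : L1Line := indicatorConstLp 1 measurableSet_Ioo hvol 1 with hh
    have hint : ∫ x, h x = 1 := by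
      rw [hh, integral_congr_ae indicatorConstLp_coeFn, integral_indicator measurableSet_Ioo]
      simp
    have hadd : ∀ f g : L1Line, ∫ x, (f - g) x = (∫ x, f x) - ∫ x, g x := fun f g => by
      rw [integral_congr_ae (Lp.coeFn_sub f g)]
      exact integral_sub (L1.integrable_coeFn f) (L1.integrable_coeFn g)
    have hsmul : ∀ (c : ℝ) (g : L1Line), ∫ x, (c • g) x = c * ∫ x, g x := fun c g => by
      rw [integral_congr_ae (Lp.coeFn_smul c g)]
      exact integral_smul c _
    let P : L1Plane →L[ℝ] L1Plane :=
      ContinuousLinearMap.id ℝ L1Plane - (mulProd h).comp fstMarginal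
    have hPF : P F = F := by
      change F - mulProd h (fstMarginal F) = F
      rw [(mem_zeroFstIntegral_iff F).1 hF, map_zero, sub_zero]
    have hP : (⊤ : Submodule ℝ L1Plane) ≤
        Submodule.comap (P : L1Plane →ₗ[ℝ] L1Plane) (Submodule.span ℝ
          {F | ∃ f g, ∫ x, f x = 0 ∧ F = mulProd f g}).topologicalClosure := by
      rw [← closure_span_mulProd]
      refine Submodule.topologicalClosure_minimal _ (Submodule.span_le.2 ?_)
        ((Submodule.isClosed_topologicalClosure _).preimage P.continuous)
      rintro _ ⟨f, g, rfl⟩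
      refine Submodule.le_topologicalClosure _ (Submodule.subset_span
        ⟨f - (∫ x, f x) • h, g, ?_, ?_⟩)
      · rw [hadd, hsmul, hint, mul_one, sub_self]
      · change mulProd f g - mulProd h (fstMarginal (mulProd f g)) = _
        rw [fstMarginal_mulProd]
        simp
    have := hP (Submodule.mem_top (x := F))
    rwa [Submodule.mem_comap, ContinuousLinearMap.coe_coe, hPF] at this
  · refine Submodule.topologicalClosure_minimal _ (Submodule.span_le.2 ?_)
      isClosed_zeroFstIntegral
    rintro _ ⟨f, g, hf, rfl⟩
    rw [SetLike.mem_coe, mem_zeroFstIntegral_iff, fstMarginal_mulProd, hf, zero_smul]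

/-- The isometry `F(x, y) ↦ F(y, x)` of `L¹(ℝ²)`. -/
def swapL1 : L1Plane →ₗᵢ[ℝ] L1Plane :=
  Lp.compMeasurePreservingₗᵢ ℝ Prod.swap Measure.measurePreserving_swap

theorem coeFn_swapL1 (F : L1Plane) : ∀ᵐ p : ℝ × ℝ, swapL1 F p = F p.swap :=
  Lp.coeFn_compMeasurePreserving F Measure.measurePreserving_swap

theorem swapL1_swapL1 (F : L1Plane) : swapL1 (swapL1 F) = F := by
  refine Lp.ext ?_
  filter_upwards [coeFn_swapL1 (swapL1 F),
    Measure.measurePreserving_swap.quasiMeasurePreserving.ae (coeFn_swapL1 F)] with p h1 h2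
  rw [h1, h2, Prod.swap_swap]

theorem swapL1_mulProd (f g : L1Line) : swapL1 (mulProd f g) = mulProd g f := by
  refine Lp.ext ?_
  filter_upwards [coeFn_swapL1 (mulProd f g), coeFn_mulProd g f,
    Measure.measurePreserving_swap.quasiMeasurePreserving.ae (coeFn_mulProd f g)] with p h1 h2 h3
  rw [h1, h2, h3, mul_comm]; rfl

theorem swapL1_mem_zeroFstIntegral_iff (F : L1Plane) :
    swapL1 F ∈ zeroFstIntegral ↔ F ∈ zeroSndIntegral := by
  change (∀ᵐ y : ℝ, ∫ x : ℝ, swapL1 F (x, y) = 0) ↔ ∀ᵐ x : ℝ, ∫ y : ℝ, F (x, y) = 0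
  refine Filter.eventually_congr ?_
  filter_upwards [ae_ae_fst (coeFn_swapL1 F)] with y hy
  rw [integral_congr_ae hy]; rfl

theorem zeroSndIntegral_eq_closure :
    zeroSndIntegral =
      (Submodule.span ℝ {F | ∃ f g, ∫ x, g x = 0 ∧ F = mulProd f g}).topologicalClosure := by
  have hspan : ∀ F : L1Plane,
      F ∈ (Submodule.span ℝ {F | ∃ f g, ∫ x, f x = 0 ∧ F = mulProd f g}).topologicalClosure →
      swapL1 F ∈
        (Submodule.span ℝ {F | ∃ f g, ∫ x, g x = 0 ∧ F = mulProd f g}).topologicalClosure := by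
    intro F hF
    have hle : (Submodule.span ℝ {F | ∃ f g, ∫ x, f x = 0 ∧ F = mulProd f g}).topologicalClosure ≤
        Submodule.comap swapL1.toLinearMap (Submodule.span ℝ
          {F | ∃ f g, ∫ x, g x = 0 ∧ F = mulProd f g}).topologicalClosure := by
      refine Submodule.topologicalClosure_minimal _ (Submodule.span_le.2 ?_)
        ((Submodule.isClosed_topologicalClosure _).preimage swapL1.continuous)
      rintro _ ⟨f, g, hf, rfl⟩
      refine Submodule.le_topologicalClosure _ (Submodule.subset_span ⟨g, f, hf, ?_⟩)
      exact swapL1_mulProd f g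
    exact hle hF
  refine le_antisymm (fun F hF => ?_) ?_
  · rw [← swapL1_mem_zeroFstIntegral_iff, zeroFstIntegral_eq_closure] at hF
    simpa only [swapL1_swapL1] using hspan _ hF
  · refine Submodule.topologicalClosure_minimal _ (Submodule.span_le.2 ?_) ?_
    · rintro _ ⟨f, g, hg, rfl⟩
      rw [SetLike.mem_coe, ← swapL1_mem_zeroFstIntegral_iff, swapL1_mulProd,
        mem_zeroFstIntegral_iff, fstMarginal_mulProd, hg, zero_smul]
    · have : (zeroSndIntegral : Set L1Plane) = swapL1 ⁻¹' zeroFstIntegral :=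
        Set.ext fun F => (swapL1_mem_zeroFstIntegral_iff F).symm
      rw [this]
      exact isClosed_zeroFstIntegral.preimage swapL1.continuous

/-! ### The free space of the line -/

theorem isClosed_range_isometry {E F : Type*} [NormedAddCommGroup E] [NormedSpace ℝ E]
    [CompleteSpace E] [NormedAddCommGroup F] [NormedSpace ℝ F] (L : E →ₗᵢ[ℝ] F) :
    IsClosed (LinearMap.range L.toLinearMap : Set F) := by
  rw [LinearMap.coe_range]
  exact L.isometry.isClosedEmbedding.isClosed_range

theorem LipZero.lipschitzWith (f : LipZero ℝ) : LipschitzWith ⟨lipConst f, lipConst_nonneg f⟩ f :=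
  LipschitzWith.of_dist_le_mul fun x y => by
    rw [Real.dist_eq, dist_eq_norm]; exact abs_sub_le_lipConst f x y

theorem LipZero.norm_deriv_le (f : LipZero ℝ) (t : ℝ) : ‖deriv f t‖ ≤ ‖f‖ :=
  norm_deriv_le_of_lipschitz f.lipschitzWith

theorem LipZero.ae_differentiableAt (f : LipZero ℝ) : ∀ᵐ t, DifferentiableAt ℝ f t :=
  f.lipschitzWith.ae_differentiableAt_real

theorem LipZero.integral_deriv (f : LipZero ℝ) (a b : ℝ) : ∫ t in a..b, deriv f t = f b - f a :=
  (f.lipschitzWith.lipschitzOnWith).absolutelyContinuousOnInterval.integral_deriv_eq_sub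

theorem LipZero.integrable_mul_deriv (g : L1Line) (f : LipZero ℝ) :
    Integrable (fun t => g t * deriv f t) :=
  (L1.integrable_coeFn g).mul_bdd (c := ‖f‖) (measurable_deriv f).aestronglyMeasurable
    (Filter.Eventually.of_forall f.norm_deriv_le)

/-- The functional `f ↦ ∫ g f'` on `Lip₀(ℝ)`, as a linear function of `g ∈ L¹(ℝ)`. -/
def derivPairing : L1Line →L[ℝ] StrongDual ℝ (LipZero ℝ) :=
  LinearMap.mkContinuous₂
    (LinearMap.mk₂ ℝ (fun (g : L1Line) (f : LipZero ℝ) => ∫ t, g t * deriv f t)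
      (fun g g' f => by
        rw [← integral_add (LipZero.integrable_mul_deriv g f) (LipZero.integrable_mul_deriv g' f)]
        refine integral_congr_ae ?_
        filter_upwards [Lp.coeFn_add g g'] with t ht
        rw [ht, Pi.add_apply, add_mul])
      (fun c g f => by
        rw [smul_eq_mul, ← integral_const_mul]
        refine integral_congr_ae ?_
        filter_upwards [Lp.coeFn_smul c g] with t ht
        rw [ht, Pi.smul_apply, smul_eq_mul, mul_assoc])
      (fun g f f' => by
        rw [← integral_add (LipZero.integrable_mul_deriv g f) (LipZero.integrable_mul_deriv g f')]
        refine integral_congr_ae ?_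
        filter_upwards [f.ae_differentiableAt, f'.ae_differentiableAt] with t h h'
        have : deriv (f + f' : LipZero ℝ) t = deriv f t + deriv f' t := deriv_add h h'
        rw [this, mul_add])
      (fun c g f => by
        rw [smul_eq_mul, ← integral_const_mul]
        refine integral_congr_ae ?_
        filter_upwards [f.ae_differentiableAt] with t h
        have : deriv (c • f : LipZero ℝ) t = c * deriv f t := deriv_const_mul c h
        rw [this, mul_left_comm])) 1 (fun g f => by
    rw [one_mul, LinearMap.mk₂_apply, L1.norm_eq_integral_norm g, ← integral_mul_const]
    refine norm_integral_le_of_norm_le ((L1.integrable_coeFn g).norm.mul_const _)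
      (Filter.Eventually.of_forall fun t => ?_)
    rw [norm_mul]
    exact mul_le_mul_of_nonneg_left (f.norm_deriv_le t) (norm_nonneg _))

theorem derivPairing_apply (g : L1Line) (f : LipZero ℝ) :
    derivPairing g f = ∫ t, g t * deriv f t := rfl

/-- A measurable function with values in `[-1, 1]` is almost everywhere the derivative of a
function in the unit ball of `Lip₀(ℝ)`, namely of its primitive. -/
theorem exists_lipZero_deriv_eq {s : ℝ → ℝ} (hs : Measurable s) (hb : ∀ t, ‖s t‖ ≤ 1) :
    ∃ f : LipZero ℝ, ‖f‖ ≤ 1 ∧ ∀ᵐ t, deriv f t = s t := by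
  have hloc : LocallyIntegrable s := (locallyIntegrable_const (1 : ℝ)).mono
    hs.aestronglyMeasurable (Filter.Eventually.of_forall fun t => by simpa using hb t)
  have hint : ∀ a b : ℝ, IntervalIntegrable s volume a b := fun a b =>
    (hloc.integrableOn_isCompact isCompact_uIcc).intervalIntegrable
  have hlip : ∀ x y : ℝ, |(∫ t in (0 : ℝ)..x, s t) - ∫ t in (0 : ℝ)..y, s t| ≤ 1 * ‖x - y‖ := by
    intro x y
    rw [intervalIntegral.integral_interval_sub_left (hint _ _) (hint _ _)]
    exact intervalIntegral.norm_integral_le_of_norm_le_const fun t _ => hb t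
  let f : LipZero ℝ := ⟨fun x => ∫ t in (0 : ℝ)..x, s t, by simp, 1, hlip⟩
  refine ⟨f, lipConst_le zero_le_one hlip, ?_⟩
  filter_upwards [LocallyIntegrable.ae_hasDerivAt_integral hloc] with t ht
  exact (ht 0).deriv

theorem norm_derivPairing (g : L1Line) : ‖derivPairing g‖ = ‖g‖ := by
  refine le_antisymm ?_ ?_
  · have h : ‖derivPairing‖ ≤ 1 := LinearMap.mkContinuous₂_norm_le _ zero_le_one _
    simpa using derivPairing.le_of_opNorm_le h g
  · -- test against the primitive of the sign of `g`
    obtain ⟨f, hf, hfs⟩ := exists_lipZero_deriv_eq (s := fun t => if 0 ≤ g t then 1 else -1)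
      (Measurable.ite (measurableSet_le measurable_const (Lp.stronglyMeasurable g).measurable)
        measurable_const measurable_const) (fun t => by split_ifs <;> simp)
    have h1 : derivPairing g f = ‖g‖ := by
      rw [derivPairing_apply, L1.norm_eq_integral_norm]
      refine integral_congr_ae ?_
      filter_upwards [hfs] with t ht
      rw [ht, Real.norm_eq_abs]
      split_ifs with h0
      · rw [mul_one, abs_of_nonneg h0]
      · rw [mul_neg_one, abs_of_neg (not_le.1 h0)]
    calc ‖g‖ = derivPairing g f := h1.symm
      _ ≤ ‖derivPairing g f‖ := le_abs_self _
      _ ≤ ‖derivPairing g‖ * ‖f‖ := (derivPairing g).le_opNorm f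
      _ ≤ ‖derivPairing g‖ := mul_le_of_le_one_right (norm_nonneg _) hf

/-- The signed indicator function of the interval between `0` and `x`, in `L¹(ℝ)`. -/
def signedInterval (x : ℝ) : L1Line :=
  indicatorConstLp 1 (measurableSet_Ioo (a := 0) (b := x)) measure_Ioo_lt_top.ne 1 -
    indicatorConstLp 1 (measurableSet_Ioo (a := x) (b := 0)) measure_Ioo_lt_top.ne 1

theorem coeFn_signedInterval (x : ℝ) : ∀ᵐ t : ℝ, signedInterval x t =
    (Set.Ioo 0 x).indicator (fun _ => (1 : ℝ)) t - (Set.Ioo x 0).indicator (fun _ => (1 : ℝ)) t := by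
  rw [signedInterval]
  filter_upwards [Lp.coeFn_sub (indicatorConstLp 1 (measurableSet_Ioo (a := 0) (b := x))
      measure_Ioo_lt_top.ne (1 : ℝ)) (indicatorConstLp 1 (measurableSet_Ioo (a := x) (b := 0))
      measure_Ioo_lt_top.ne (1 : ℝ)),
    indicatorConstLp_coeFn (p := 1) (hs := measurableSet_Ioo (a := 0) (b := x))
      (hμs := measure_Ioo_lt_top.ne) (c := (1 : ℝ)) (μ := volume),
    indicatorConstLp_coeFn (p := 1) (hs := measurableSet_Ioo (a := x) (b := 0))
      (hμs := measure_Ioo_lt_top.ne) (c := (1 : ℝ)) (μ := volume)] with t h1 h2 h3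
  rw [h1, Pi.sub_apply, h2, h3]

theorem derivPairing_signedInterval (x : ℝ) : derivPairing (signedInterval x) = evalDual x := by
  ext f
  have hf : ∀ a b : ℝ, IntegrableOn (deriv f) (Set.Ioo a b) := fun a b =>
    Measure.integrableOn_of_bounded measure_Ioo_lt_top.ne
      (measurable_deriv f).aestronglyMeasurable (Filter.Eventually.of_forall f.norm_deriv_le)
  have h1 : ∫ t, signedInterval x t * deriv f t =
      ∫ t, ((Set.Ioo 0 x).indicator (deriv f) t - (Set.Ioo x 0).indicator (deriv f) t) := by
    refine integral_congr_ae ?_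
    filter_upwards [coeFn_signedInterval x] with t ht
    rw [ht]
    by_cases h1 : t ∈ Set.Ioo 0 x <;> by_cases h2 : t ∈ Set.Ioo x 0 <;> simp [h1, h2]
  rw [derivPairing_apply, h1, integral_sub ((hf _ _).integrable_indicator measurableSet_Ioo)
    ((hf _ _).integrable_indicator measurableSet_Ioo), integral_indicator measurableSet_Ioo,
    integral_indicator measurableSet_Ioo, ← integral_Ioc_eq_integral_Ioo,
    ← integral_Ioc_eq_integral_Ioo]
  change ∫ t in (0 : ℝ)..x, deriv f t = f x
  rw [f.integral_deriv, f.map_zero, sub_zero]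

theorem closure_span_signedInterval :
    (Submodule.span ℝ (Set.range signedInterval)).topologicalClosure = ⊤ := by
  refine eq_top_of_containsIndicator (Submodule.isClosed_topologicalClosure _)
    ((BorelSpace.measurable_eq (α := ℝ)).trans (borel_eq_generateFrom_Ioc ℝ)) ?_
    (K := fun n : ℕ => Set.Ioc (-(n + 1 : ℝ)) (n + 1)) (fun n => ⟨_, _, ?_, rfl⟩)
    (fun n => measure_Ioc_lt_top.ne) (fun a b hab => ?_) ?_ ?_
  · simpa using isPiSystem_Ioc (id : ℝ → ℝ) (id : ℝ → ℝ)
  · have : (0 : ℝ) ≤ n := n.cast_nonneg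
    linarith
  · have : (a : ℝ) ≤ b := Nat.cast_le.2 hab
    exact Set.Ioc_subset_Ioc (by linarith) (by linarith)
  · refine Set.eq_univ_of_forall fun x => ?_
    obtain ⟨n, hn⟩ := exists_nat_ge |x|
    have := abs_le.1 hn
    exact Set.mem_iUnion.2 ⟨n, by linarith, by linarith⟩
  · rintro _ ⟨a, b, hab, rfl⟩ -
    refine ⟨signedInterval b - signedInterval a, Submodule.sub_mem _
      (Submodule.le_topologicalClosure _ (Submodule.subset_span ⟨b, rfl⟩))
      (Submodule.le_topologicalClosure _ (Submodule.subset_span ⟨a, rfl⟩)), ?_⟩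
    filter_upwards [Lp.coeFn_sub (signedInterval b) (signedInterval a), coeFn_signedInterval a,
      coeFn_signedInterval b, Measure.ae_ne volume (0 : ℝ), Measure.ae_ne volume a,
      Measure.ae_ne volume b] with t h ha hb h0 h1 h2
    rw [h, Pi.sub_apply, ha, hb]
    simp only [Set.indicator_apply, Set.mem_Ioo, Set.mem_Ioc]
    rcases lt_or_gt_of_ne h0 with h0 | h0 <;> rcases lt_or_gt_of_ne h1 with h1 | h1 <;>
      rcases lt_or_gt_of_ne h2 with h2 | h2 <;>
      first
      | (exfalso; linarith)
      | simp [h0, h1, h2, h0.not_gt, h1.not_gt, h2.not_gt, h2.le, h2.not_ge]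

/-- The map `g ↦ (f ↦ ∫ g f')` as an isometry of `L¹(ℝ)` into the dual of `Lip₀(ℝ)`. -/
def derivIsometry : L1Line →ₗᵢ[ℝ] StrongDual ℝ (LipZero ℝ) :=
  ⟨derivPairing, norm_derivPairing⟩

theorem range_derivIsometry : LinearMap.range derivIsometry.toLinearMap = lipFreeSubmodule ℝ := by
  refine le_antisymm ?_ ?_
  · rintro _ ⟨g, rfl⟩
    have hle : (⊤ : Submodule ℝ L1Line) ≤
        Submodule.comap derivIsometry.toLinearMap (lipFreeSubmodule ℝ) := by
      rw [← closure_span_signedInterval]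
      refine Submodule.topologicalClosure_minimal _ (Submodule.span_le.2 ?_)
        ((Submodule.isClosed_topologicalClosure _).preimage derivIsometry.continuous)
      rintro _ ⟨x, rfl⟩
      change derivPairing (signedInterval x) ∈ lipFreeSubmodule ℝ
      rw [derivPairing_signedInterval]
      exact (delta x).2
    exact hle (Submodule.mem_top (x := g))
  · refine Submodule.topologicalClosure_minimal _ (Submodule.span_le.2 ?_)
      (isClosed_range_isometry _)
    rintro _ ⟨x, rfl⟩
    exact ⟨signedInterval x, derivPairing_signedInterval x⟩

/-- The isometric isomorphism of `F(ℝ)` onto `L¹(ℝ)`, the inverse of `g ↦ (f ↦ ∫ g f')`. -/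
def lipFreeEquiv : LipFree ℝ ≃ₗᵢ[ℝ] L1Line :=
  (derivIsometry.equivRange.trans (LinearIsometryEquiv.ofEq _ _ range_derivIsometry)).symm

theorem incl_lipFreeEquiv_symm (g : L1Line) :
    LipFree.incl ℝ (lipFreeEquiv.symm g) = derivPairing g := rfl

theorem derivPairing_lipFreeEquiv (μ : LipFree ℝ) :
    derivPairing (lipFreeEquiv μ) = LipFree.incl ℝ μ := by
  rw [← incl_lipFreeEquiv_symm, LinearIsometryEquiv.symm_apply_apply]

theorem lipFreeEquiv_delta (x : ℝ) : lipFreeEquiv (delta x) = signedInterval x :=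
  derivIsometry.injective
    ((derivPairing_lipFreeEquiv (delta x)).trans (derivPairing_signedInterval x).symm)

theorem integral_lipFreeEquiv (μ : LipFree ℝ) : ∫ t, lipFreeEquiv μ t = beta μ := by
  change _ = LipFree.incl ℝ μ lipId
  rw [← derivPairing_lipFreeEquiv, derivPairing_apply]
  have : ∀ t, deriv lipId t = 1 := fun t => deriv_id t
  simp only [this, mul_one]

/-! ### Linear maps on the projective tensor product -/

section Projective

variable {E G H : Type*} [NormedAddCommGroup E] [NormedSpace ℝ E]
  [NormedAddCommGroup G] [NormedSpace ℝ G] [NormedAddCommGroup H] [NormedSpace ℝ H]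

/-- The linear map on the algebraic tensor product induced by a bilinear map. -/
def algLift (B : E →L[ℝ] G →L[ℝ] H) : AlgProjTensor E G →ₗ[ℝ] H :=
  TensorProduct.lift (B.toLinearMap₁₂)

theorem algLift_algTmul (B : E →L[ℝ] G →L[ℝ] H) (a : E) (b : G) :
    algLift B (algTmul a b) = B a b :=
  TensorProduct.lift.tmul a b

theorem exists_eq_sum_algTmul (u : AlgProjTensor E G) :
    ∃ (n : ℕ) (a : Fin n → E) (b : Fin n → G), u = ∑ i, algTmul (a i) (b i) :=
  TensorProduct.exists_sum_tmul_eq u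

theorem norm_algTmul_le (a : E) (b : G) : ‖algTmul a b‖ ≤ ‖a‖ * ‖b‖ :=
  csInf_le (projCosts_bddBelow _) ⟨[(a, b)], by simp [algTmul], by simp⟩

theorem norm_algLift_le {B : E →L[ℝ] G →L[ℝ] H} (hB : ∀ a b, ‖B a b‖ ≤ ‖a‖ * ‖b‖)
    (u : AlgProjTensor E G) : ‖algLift B u‖ ≤ ‖u‖ := by
  refine le_csInf (projCosts_nonempty _) ?_
  rintro _ ⟨l, hu, rfl⟩
  have hu' : u = (l.map fun p => algTmul p.1 p.2).sum := hu
  rw [hu', map_list_sum, List.map_map]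
  clear hu hu'
  induction l with
  | nil => simp
  | cons p l ih =>
    simp only [List.map_cons, List.sum_cons, Function.comp_apply] at ih ⊢
    refine (norm_add_le _ _).trans (add_le_add ?_ ih)
    rw [algLift_algTmul]
    exact hB _ _

/-- The flip `a ⊗ b ↦ b ⊗ a` of the algebraic tensor product. -/
def algComm : AlgProjTensor E G ≃ₗ[ℝ] AlgProjTensor G E := TensorProduct.comm ℝ E G

theorem norm_algComm_le (u : AlgProjTensor E G) : ‖algComm u‖ ≤ ‖u‖ := by
  refine le_csInf (projCosts_nonempty _) ?_
  rintro _ ⟨l, hu, rfl⟩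
  refine csInf_le (projCosts_bddBelow _) ⟨l.map Prod.swap, ?_, ?_⟩
  · have hu' : u = (l.map fun p => algTmul p.1 p.2).sum := hu
    rw [hu', map_list_sum, List.map_map, List.map_map]
    rfl
  · rw [List.map_map]
    simp only [Function.comp_def, Prod.fst_swap, Prod.snd_swap, mul_comm]

theorem norm_algComm (u : AlgProjTensor E G) : ‖algComm u‖ = ‖u‖ :=
  le_antisymm (norm_algComm_le u) (norm_algComm_le (algComm u) |>.trans' (by
    have : algComm (algComm u) = u := TensorProduct.comm_comm ℝ G E u
    rw [this]))

/-- The elementary tensors span a dense subspace of the completed projective tensor product. -/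
theorem closure_span_ptmul :
    (Submodule.span ℝ {ξ : ProjTensor E G | ∃ a b, ξ = ptmul a b}).topologicalClosure = ⊤ := by
  refine Submodule.eq_top_iff'.2 fun ξ => ?_
  induction ξ using UniformSpace.Completion.induction_on with
  | hp => exact Submodule.isClosed_topologicalClosure _
  | ih u =>
    refine Submodule.le_topologicalClosure _ ?_
    obtain ⟨n, a, b, rfl⟩ := exists_eq_sum_algTmul u
    change UniformSpace.Completion.toComplₗᵢ (𝕜 := ℝ) (∑ i, algTmul (a i) (b i)) ∈ _
    rw [map_sum]
    exact Submodule.sum_mem _ fun i _ => Submodule.subset_span ⟨a i, b i, rfl⟩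

/-- A bilinear map whose linearization on the algebraic tensor product preserves the projective
norm extends to an isometry of the completed tensor product. -/
theorem exists_linearIsometry_of_norm_algLift [CompleteSpace H] {B : E →L[ℝ] G →L[ℝ] H}
    (hB : ∀ u, ‖algLift B u‖ = ‖u‖) :
    ∃ L : ProjTensor E G →ₗᵢ[ℝ] H, ∀ a b, L (ptmul a b) = B a b := by
  let e : AlgProjTensor E G →ₗᵢ[ℝ] ProjTensor E G := UniformSpace.Completion.toComplₗᵢ
  have hd : DenseRange e.toLinearMap := UniformSpace.Completion.denseRange_coe
  have hle : ∀ u, ‖algLift B u‖ ≤ 1 * ‖e.toLinearMap u‖ := fun u => by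
    rw [one_mul, hB]; exact (e.norm_map u).ge
  let L : ProjTensor E G →L[ℝ] H := (algLift B).extendOfNorm e.toLinearMap
  have hL : ∀ u, L (e u) = algLift B u := LinearMap.extendOfNorm_eq hd ⟨1, hle⟩
  refine ⟨⟨L, fun ξ => ?_⟩, fun a b => (hL (algTmul a b)).trans (algLift_algTmul B a b)⟩
  induction ξ using UniformSpace.Completion.induction_on with
  | hp => exact isClosed_eq L.continuous.norm continuous_norm
  | ih u => exact (congrArg norm (hL u)).trans ((hB u).trans (e.norm_map u).symm)

/-- The range of an isometry of the completed tensor product is the closed linear span of the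
images of the elementary tensors. -/
theorem range_linearIsometry (L : ProjTensor E G →ₗᵢ[ℝ] H) :
    LinearMap.range L.toLinearMap =
      (Submodule.span ℝ {h | ∃ a b, h = L (ptmul a b)}).topologicalClosure := by
  refine le_antisymm ?_ ?_
  · rintro _ ⟨ξ, rfl⟩
    have hle : (⊤ : Submodule ℝ (ProjTensor E G)) ≤ Submodule.comap L.toLinearMap
        (Submodule.span ℝ {h | ∃ a b, h = L (ptmul a b)}).topologicalClosure := by
      rw [← closure_span_ptmul]
      refine Submodule.topologicalClosure_minimal _ (Submodule.span_le.2 ?_)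
        ((Submodule.isClosed_topologicalClosure _).preimage L.continuous)
      rintro _ ⟨a, b, rfl⟩
      exact Submodule.le_topologicalClosure _ (Submodule.subset_span ⟨a, b, rfl⟩)
    exact hle (Submodule.mem_top (x := ξ))
  · refine Submodule.topologicalClosure_minimal _ (Submodule.span_le.2 ?_) ?_
    · rintro _ ⟨a, b, rfl⟩
      exact ⟨ptmul a b, rfl⟩
    · exact isClosed_range_isometry L

/-- An isometry of the completed tensor product, restricted to its range. -/
theorem exists_equiv_of_linearIsometry (L : ProjTensor E G →ₗᵢ[ℝ] H) {Z : Submodule ℝ H}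
    (hZ : Z = (Submodule.span ℝ {h | ∃ a b, h = L (ptmul a b)}).topologicalClosure) :
    ∃ Ψ : ProjTensor E G ≃ₗᵢ[ℝ] Z, ∀ ξ, (Ψ ξ : H) = L ξ :=
  ⟨L.equivRange.trans (LinearIsometryEquiv.ofEq _ _ ((range_linearIsometry L).trans hZ.symm)),
    fun _ => rfl⟩

theorem mem_closedSpanTensors_iff (Φ : ProjTensor E G ≃ₗᵢ[ℝ] H) {A : Submodule ℝ E}
    {B : Submodule ℝ G} {Z : Submodule ℝ H}
    (hZ : Z = (Submodule.span ℝ {h | ∃ a ∈ A, ∃ b ∈ B, h = Φ (ptmul a b)}).topologicalClosure)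
    (ξ : ProjTensor E G) : ξ ∈ closedSpanTensors A B ↔ Φ ξ ∈ Z := by
  have h1 : closedSpanTensors A B ≤ Submodule.comap Φ.toLinearEquiv.toLinearMap Z := by
    refine Submodule.topologicalClosure_minimal _ (Submodule.span_le.2 ?_) ?_
    · rintro _ ⟨a, ha, b, hb, rfl⟩
      change Φ (ptmul a b) ∈ Z
      rw [hZ]
      exact Submodule.le_topologicalClosure _ (Submodule.subset_span ⟨a, ha, b, hb, rfl⟩)
    · have : IsClosed (Z : Set H) := hZ ▸ Submodule.isClosed_topologicalClosure _
      exact this.preimage Φ.continuous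
  have h2 : Z ≤ Submodule.comap Φ.symm.toLinearEquiv.toLinearMap (closedSpanTensors A B) := by
    rw [hZ]
    refine Submodule.topologicalClosure_minimal _ (Submodule.span_le.2 ?_)
      ((Submodule.isClosed_topologicalClosure _).preimage Φ.symm.continuous)
    rintro _ ⟨a, ha, b, hb, rfl⟩
    change Φ.symm (Φ (ptmul a b)) ∈ closedSpanTensors A B
    rw [Φ.symm_apply_apply]
    exact Submodule.le_topologicalClosure _ (Submodule.subset_span ⟨a, ha, b, hb, rfl⟩)
  refine ⟨fun h => h1 h, fun h => ?_⟩
  have : Φ.symm (Φ ξ) ∈ closedSpanTensors A B := h2 h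
  rwa [Φ.symm_apply_apply] at this

end Projective

/-! ### Tensor products of subspaces of `L¹(ℝ)` with `L¹(ℝ)` -/

section Isometry

variable {E G : Type*} [NormedAddCommGroup E] [NormedSpace ℝ E]
  [NormedAddCommGroup G] [NormedSpace ℝ G]

/-- The bilinear map `(a, b) ↦ (j a)(x) (k b)(y)`, for isometries `j` and `k` into `L¹(ℝ)`. -/
def mulProdOf (j : E →ₗᵢ[ℝ] L1Line) (k : G →ₗᵢ[ℝ] L1Line) : E →L[ℝ] G →L[ℝ] L1Plane :=
  mulProd.bilinearComp j.toContinuousLinearMap k.toContinuousLinearMap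

theorem mulProdOf_apply (j : E →ₗᵢ[ℝ] L1Line) (k : G →ₗᵢ[ℝ] L1Line) (a : E) (b : G) :
    mulProdOf j k a b = mulProd (j a) (k b) := rfl

theorem norm_mulProdOf (j : E →ₗᵢ[ℝ] L1Line) (k : G →ₗᵢ[ℝ] L1Line) (a : E) (b : G) :
    ‖mulProdOf j k a b‖ = ‖a‖ * ‖b‖ := by
  rw [mulProdOf_apply, norm_mulProd, j.norm_map, k.norm_map]

theorem coeFn_sum_L1Plane {n : ℕ} (F : Fin n → L1Plane) :
    ∀ᵐ p, (∑ i, F i : L1Plane) p = ∑ i, F i p := by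
  induction n with
  | zero =>
    filter_upwards [Lp.coeFn_zero ℝ 1 (volume : Measure (ℝ × ℝ))] with p hp
    simp
  | succ n ih =>
    filter_upwards [ih fun i => F i.succ, Lp.coeFn_add (F 0) (∑ i : Fin n, F i.succ)] with p h1 h2
    rw [Fin.sum_univ_succ, h2, Pi.add_apply, h1, Fin.sum_univ_succ]

/-- The map `b ↦ a ⊗ b`. -/
def algTmulRight (a : E) : G →L[ℝ] AlgProjTensor E G :=
  LinearMap.mkContinuous (TensorProduct.mk ℝ E G a : G →ₗ[ℝ] AlgProjTensor E G) ‖a‖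
    (norm_algTmul_le a)

/-- For fixed `a₁, …, aₙ`, the continuous linear map sending an integrable function `c` with
values in `ℝⁿ` to the tensor `∑ aᵢ ⊗ cᵢ`. -/
def tensorOfCoeff (k : G ≃ₗᵢ[ℝ] L1Line) {n : ℕ} (a : Fin n → E) :
    Lp (Fin n → ℝ) 1 (volume : Measure ℝ) →L[ℝ] AlgProjTensor E G :=
  ∑ i, (algTmulRight (a i)).comp
    ((k.symm.toContinuousLinearEquiv : L1Line →L[ℝ] G).comp
      ((ContinuousLinearMap.proj (R := ℝ) (φ := fun _ : Fin n => ℝ) i).compLpL 1 volume))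

theorem tensorOfCoeff_apply (k : G ≃ₗᵢ[ℝ] L1Line) {n : ℕ} (a : Fin n → E)
    (c : Lp (Fin n → ℝ) 1 (volume : Measure ℝ)) :
    tensorOfCoeff k a c = ∑ i, algTmul (a i) (k.symm
      ((ContinuousLinearMap.proj (R := ℝ) (φ := fun _ : Fin n => ℝ) i).compLpL 1 volume c)) := by
  rw [tensorOfCoeff, sum_apply]
  rfl

theorem exists_eq_tensorOfCoeff (k : G ≃ₗᵢ[ℝ] L1Line) (u : AlgProjTensor E G) :
    ∃ (n : ℕ) (a : Fin n → E) (c : Lp (Fin n → ℝ) 1 (volume : Measure ℝ)),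
      u = tensorOfCoeff k a c := by
  obtain ⟨n, a, b, rfl⟩ := exists_eq_sum_algTmul u
  have hc : Integrable fun t => fun i => k (b i) t :=
    Integrable.of_eval fun i => L1.integrable_coeFn (k (b i))
  refine ⟨n, a, hc.toL1 _, ?_⟩
  rw [tensorOfCoeff_apply]
  refine Finset.sum_congr rfl fun i _ => ?_
  congr 1
  rw [LinearIsometryEquiv.eq_symm_apply]
  refine Lp.ext ?_
  filter_upwards [ContinuousLinearMap.coeFn_compLpL (p := 1) (μ := volume)
    (ContinuousLinearMap.proj (R := ℝ) (φ := fun _ : Fin n => ℝ) i) (hc.toL1 _), hc.coeFn_toL1]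
    with t h1 h2
  rw [h1, h2]
  rfl

theorem coeFn_algLift_tensorOfCoeff (j : E →ₗᵢ[ℝ] L1Line) (k : G ≃ₗᵢ[ℝ] L1Line) {n : ℕ}
    (a : Fin n → E) (c : Lp (Fin n → ℝ) 1 (volume : Measure ℝ)) :
    ∀ᵐ p : ℝ × ℝ, algLift (mulProdOf j k.toLinearIsometry) (tensorOfCoeff k a c) p =
      ∑ i, j (a i) p.1 * c p.2 i := by
  set b : Fin n → L1Line := fun i =>
    (ContinuousLinearMap.proj (R := ℝ) (φ := fun _ : Fin n => ℝ) i).compLpL 1 volume c with hb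
  have h0 : algLift (mulProdOf j k.toLinearIsometry) (tensorOfCoeff k a c) =
      ∑ i, mulProd (j (a i)) (b i) := by
    rw [tensorOfCoeff_apply, map_sum]
    refine Finset.sum_congr rfl fun i _ => ?_
    rw [algLift_algTmul, mulProdOf_apply, LinearIsometryEquiv.coe_toLinearIsometry,
      LinearIsometryEquiv.apply_symm_apply]
  have h1 : ∀ᵐ p : ℝ × ℝ, ∀ i, mulProd (j (a i)) (b i) p = j (a i) p.1 * b i p.2 :=
    ae_all_iff.2 fun i => coeFn_mulProd _ _
  have h2 : ∀ᵐ p : ℝ × ℝ, ∀ i, b i p.2 = c p.2 i :=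
    ae_all_iff.2 fun i => ae_snd (ContinuousLinearMap.coeFn_compLpL (p := 1) (μ := volume) _ c)
  rw [h0]
  filter_upwards [coeFn_sum_L1Plane fun i => mulProd (j (a i)) (b i), h1, h2] with p h3 h4 h5
  rw [h3]
  exact Finset.sum_congr rfl fun i _ => by rw [h4, h5]

/-- On `E ⊗ L¹(ℝ)`, with `E` isometric to a subspace of `L¹(ℝ)`, the projective norm is the norm
of `L¹(ℝ²)`. For fixed `a₁, …, aₙ` the `c` such that `∑ aᵢ ⊗ cᵢ` obeys the nontrivial inequality
form a closed set; an indicator function `c = χₛ v` gives the elementary tensor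
`(∑ vᵢ aᵢ) ⊗ χₛ`, and the norm of `L¹(ℝ²)` is additive on functions `c` with disjoint supports. -/
theorem norm_algLift_mulProdOf (j : E →ₗᵢ[ℝ] L1Line) (k : G ≃ₗᵢ[ℝ] L1Line)
    (u : AlgProjTensor E G) : ‖algLift (mulProdOf j k.toLinearIsometry) u‖ = ‖u‖ := by
  have hle : ∀ u, ‖algLift (mulProdOf j k.toLinearIsometry) u‖ ≤ ‖u‖ :=
    norm_algLift_le fun a b => (norm_mulProdOf _ _ a b).le
  refine le_antisymm (hle u) ?_
  obtain ⟨n, a, c, rfl⟩ := exists_eq_tensorOfCoeff k u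
  have hcont : Continuous (algLift (mulProdOf j k.toLinearIsometry)) :=
    AddMonoidHomClass.continuous_of_bound _ 1 fun u => by rw [one_mul]; exact hle u
  refine Lp.induction ENNReal.one_ne_top (motive := fun c => ‖tensorOfCoeff k a c‖ ≤
    ‖algLift (mulProdOf j k.toLinearIsometry) (tensorOfCoeff k a c)‖) ?_ ?_ ?_ c
  · intro v s hs hμs
    rw [Lp.simpleFunc.coe_indicatorConst]
    set χ : L1Line := indicatorConstLp 1 hs hμs.ne 1 with hχ
    have h1 : ∀ i, (ContinuousLinearMap.proj (R := ℝ) (φ := fun _ : Fin n => ℝ) i).compLpL 1 volume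
        (indicatorConstLp 1 hs hμs.ne v) = v i • χ := fun i => by
      refine Lp.ext ?_
      filter_upwards [ContinuousLinearMap.coeFn_compLpL (p := 1) (μ := volume)
        (ContinuousLinearMap.proj (R := ℝ) (φ := fun _ : Fin n => ℝ) i)
        (indicatorConstLp 1 hs hμs.ne v), Lp.coeFn_smul (v i) χ,
        indicatorConstLp_coeFn (p := 1) (hs := hs) (hμs := hμs.ne) (c := v),
        indicatorConstLp_coeFn (p := 1) (hs := hs) (hμs := hμs.ne) (c := (1 : ℝ))] with t h1 h2 h3 h4
      rw [h1, h2, h3, Pi.smul_apply, hχ, h4]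
      by_cases ht : t ∈ s <;> simp [ht]
    have h2 : tensorOfCoeff k a (indicatorConstLp 1 hs hμs.ne v) =
        algTmul (∑ i, v i • a i) (k.symm χ) := by
      rw [tensorOfCoeff_apply]
      refine Eq.trans ?_ (TensorProduct.sum_tmul _ _ _).symm
      refine Finset.sum_congr rfl fun i _ => ?_
      rw [h1, map_smul]
      exact (TensorProduct.smul_tmul _ _ _).symm
    rw [h2, algLift_algTmul, norm_mulProdOf]
    exact norm_algTmul_le _ _
  · intro f g hf hg hfg ihf ihg
    have h1 : ‖algLift (mulProdOf j k.toLinearIsometry) (tensorOfCoeff k a (hf.toLp f + hg.toLp g))‖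
        = ‖algLift (mulProdOf j k.toLinearIsometry) (tensorOfCoeff k a (hf.toLp f))‖ +
          ‖algLift (mulProdOf j k.toLinearIsometry) (tensorOfCoeff k a (hg.toLp g))‖ := by
      rw [map_add, map_add, L1Plane_norm, L1Plane_norm, L1Plane_norm,
        ← integral_add (L1.integrable_coeFn _).norm (L1.integrable_coeFn _).norm]
      refine integral_congr_ae ?_
      filter_upwards [Lp.coeFn_add
        (algLift (mulProdOf j k.toLinearIsometry) (tensorOfCoeff k a (hf.toLp f)))
        (algLift (mulProdOf j k.toLinearIsometry) (tensorOfCoeff k a (hg.toLp g))),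
        coeFn_algLift_tensorOfCoeff j k a (hf.toLp f),
        coeFn_algLift_tensorOfCoeff j k a (hg.toLp g), ae_snd hf.coeFn_toLp,
        ae_snd hg.coeFn_toLp] with p h1 h2 h3 h4 h5
      rw [h1, Pi.add_apply, h2, h3, h4, h5]
      by_cases h0 : f p.2 = 0
      · simp [h0]
      · have : g p.2 = 0 := by
          by_contra h
          exact Set.disjoint_left.1 hfg h0 h
        simp [this]
    rw [h1, map_add]
    exact (norm_add_le _ _).trans (add_le_add ihf ihg)
  · exact isClosed_le (tensorOfCoeff k a).continuous.norm
      (hcont.comp (tensorOfCoeff k a).continuous).norm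

/-- The same with the factors exchanged, by the symmetry of both norms. -/
theorem norm_algLift_mulProdOf_right (k : G ≃ₗᵢ[ℝ] L1Line) (j : E →ₗᵢ[ℝ] L1Line)
    (u : AlgProjTensor G E) : ‖algLift (mulProdOf k.toLinearIsometry j) u‖ = ‖u‖ := by
  rw [← norm_algComm u, ← norm_algLift_mulProdOf j k]
  have : ∀ w : AlgProjTensor G E, algLift (mulProdOf j k.toLinearIsometry) (algComm w) =
      swapL1 (algLift (mulProdOf k.toLinearIsometry j) w) := fun w => by
    obtain ⟨n, a, b, rfl⟩ := exists_eq_sum_algTmul w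
    simp only [map_sum]
    refine Finset.sum_congr rfl fun i _ => ?_
    rw [algLift_algTmul, mulProdOf_apply, swapL1_mulProd]
    exact algLift_algTmul _ _ _
  rw [this, swapL1.norm_map]

end Isometry

/-! ### The kernel of `β` -/

theorem lipFreeEquiv_mem_kerBeta_iff (μ : LipFree ℝ) :
    μ ∈ kerBeta ↔ ∫ t, lipFreeEquiv μ t = 0 := by
  rw [integral_lipFreeEquiv]; exact LinearMap.mem_ker

theorem zeroFstIntegral_eq_closure_kerBeta : zeroFstIntegral = (Submodule.span ℝ
    {F | ∃ κ ∈ kerBeta, ∃ ν ∈ (⊤ : Submodule ℝ (LipFree ℝ)),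
      F = mulProd (lipFreeEquiv κ) (lipFreeEquiv ν)}).topologicalClosure := by
  rw [zeroFstIntegral_eq_closure]
  congr 2
  ext F
  constructor
  · rintro ⟨f, g, hf, rfl⟩
    refine ⟨lipFreeEquiv.symm f, ?_, lipFreeEquiv.symm g, Submodule.mem_top, by simp⟩
    rw [lipFreeEquiv_mem_kerBeta_iff, LinearIsometryEquiv.apply_symm_apply, hf]
  · rintro ⟨κ, hκ, ν, -, rfl⟩
    exact ⟨_, _, (lipFreeEquiv_mem_kerBeta_iff κ).1 hκ, rfl⟩

theorem zeroSndIntegral_eq_closure_kerBeta : zeroSndIntegral = (Submodule.span ℝ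
    {F | ∃ μ ∈ (⊤ : Submodule ℝ (LipFree ℝ)), ∃ κ ∈ kerBeta,
      F = mulProd (lipFreeEquiv μ) (lipFreeEquiv κ)}).topologicalClosure := by
  rw [zeroSndIntegral_eq_closure]
  congr 2
  ext F
  constructor
  · rintro ⟨f, g, hg, rfl⟩
    refine ⟨lipFreeEquiv.symm f, Submodule.mem_top, lipFreeEquiv.symm g, ?_, by simp⟩
    rw [lipFreeEquiv_mem_kerBeta_iff, LinearIsometryEquiv.apply_symm_apply, hg]
  · rintro ⟨μ, -, κ, hκ, rfl⟩
    exact ⟨_, _, (lipFreeEquiv_mem_kerBeta_iff κ).1 hκ, rfl⟩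

/-- The isometry of `ker β` into `L¹(ℝ)`. -/
def kerBetaIsometry : kerBeta →ₗᵢ[ℝ] L1Line :=
  lipFreeEquiv.toLinearIsometry.comp kerBeta.subtypeₗᵢ

theorem exists_plane_equiv : ∃ Φ : ProjTensor (LipFree ℝ) (LipFree ℝ) ≃ₗᵢ[ℝ] L1Plane,
    ∀ μ ν, Φ (ptmul μ ν) = mulProd (lipFreeEquiv μ) (lipFreeEquiv ν) := by
  obtain ⟨L, hL⟩ := exists_linearIsometry_of_norm_algLift
    (norm_algLift_mulProdOf lipFreeEquiv.toLinearIsometry lipFreeEquiv)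
  have hsurj : Function.Surjective L := by
    rw [← LinearIsometry.coe_toLinearMap, ← LinearMap.range_eq_top, range_linearIsometry,
      ← closure_span_mulProd]
    congr 2
    ext F
    constructor
    · rintro ⟨μ, ν, rfl⟩
      exact ⟨_, _, hL μ ν⟩
    · rintro ⟨f, g, rfl⟩
      refine ⟨lipFreeEquiv.symm f, lipFreeEquiv.symm g, ?_⟩
      rw [hL, mulProdOf_apply]
      simp
  exact ⟨LinearIsometryEquiv.ofSurjective L hsurj, hL⟩

theorem exists_zeroFstIntegral_equiv : ∃ Ψ : ProjTensor kerBeta (LipFree ℝ) ≃ₗᵢ[ℝ] zeroFstIntegral,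
    ∀ (κ : kerBeta) (ν : LipFree ℝ),
      (Ψ (ptmul κ ν) : L1Plane) = mulProd (lipFreeEquiv κ) (lipFreeEquiv ν) := by
  obtain ⟨L, hL⟩ := exists_linearIsometry_of_norm_algLift
    (norm_algLift_mulProdOf kerBetaIsometry lipFreeEquiv)
  have hL' : ∀ (κ : kerBeta) (ν : LipFree ℝ),
      L (ptmul κ ν) = mulProd (lipFreeEquiv κ) (lipFreeEquiv ν) := hL
  have hset : {F | ∃ κ ∈ kerBeta, ∃ ν ∈ (⊤ : Submodule ℝ (LipFree ℝ)),
      F = mulProd (lipFreeEquiv κ) (lipFreeEquiv ν)} = {F | ∃ κ ν, F = L (ptmul κ ν)} := by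
    ext F
    constructor
    · rintro ⟨κ, hκ, ν, -, rfl⟩
      exact ⟨⟨κ, hκ⟩, ν, (hL' ⟨κ, hκ⟩ ν).symm⟩
    · rintro ⟨κ, ν, rfl⟩
      exact ⟨κ, κ.2, ν, Submodule.mem_top, hL' κ ν⟩
  obtain ⟨Ψ, hΨ⟩ := exists_equiv_of_linearIsometry L
    (zeroFstIntegral_eq_closure_kerBeta.trans (by rw [hset]))
  exact ⟨Ψ, fun κ ν => (hΨ _).trans (hL' κ ν)⟩

theorem exists_zeroSndIntegral_equiv : ∃ Ψ : ProjTensor (LipFree ℝ) kerBeta ≃ₗᵢ[ℝ] zeroSndIntegral,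
    ∀ (μ : LipFree ℝ) (κ : kerBeta),
      (Ψ (ptmul μ κ) : L1Plane) = mulProd (lipFreeEquiv μ) (lipFreeEquiv κ) := by
  obtain ⟨L, hL⟩ := exists_linearIsometry_of_norm_algLift
    (norm_algLift_mulProdOf_right lipFreeEquiv kerBetaIsometry)
  have hL' : ∀ (μ : LipFree ℝ) (κ : kerBeta),
      L (ptmul μ κ) = mulProd (lipFreeEquiv μ) (lipFreeEquiv κ) := hL
  have hset : {F | ∃ μ ∈ (⊤ : Submodule ℝ (LipFree ℝ)), ∃ κ ∈ kerBeta,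
      F = mulProd (lipFreeEquiv μ) (lipFreeEquiv κ)} = {F | ∃ μ κ, F = L (ptmul μ κ)} := by
    ext F
    constructor
    · rintro ⟨μ, -, κ, hκ, rfl⟩
      exact ⟨μ, ⟨κ, hκ⟩, (hL' μ ⟨κ, hκ⟩).symm⟩
    · rintro ⟨μ, κ, rfl⟩
      exact ⟨μ, Submodule.mem_top, κ, κ.2, hL' μ κ⟩
  obtain ⟨Ψ, hΨ⟩ := exists_equiv_of_linearIsometry L
    (zeroSndIntegral_eq_closure_kerBeta.trans (by rw [hset]))
  exact ⟨Ψ, fun μ κ => (hΨ _).trans (hL' μ κ)⟩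

end LipFreeTensor
end

open LipFreeTensor in
theorem lemma5p2 :
    ∃ (φ : LipFreeTensor.LipFree ℝ ≃ₗᵢ[ℝ] LipFreeTensor.L1Line)
      (Φ : LipFreeTensor.ProjTensor (LipFreeTensor.LipFree ℝ) (LipFreeTensor.LipFree ℝ)
        ≃ₗᵢ[ℝ] LipFreeTensor.L1Plane),
      -- `φ (δ x)` is `χ_(0,x)` for `x > 0`, `-χ_(x,0)` for `x < 0`, and `0` for `x = 0`
      (∀ x : ℝ, ∀ᵐ t : ℝ, φ (LipFreeTensor.delta x) t =
        (Set.Ioo 0 x).indicator (fun _ => (1 : ℝ)) t -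
          (Set.Ioo x 0).indicator (fun _ => (1 : ℝ)) t) ∧
      (∀ μ ν : LipFreeTensor.LipFree ℝ, ∀ᵐ p : ℝ × ℝ,
        Φ (LipFreeTensor.ptmul μ ν) p = φ μ p.1 * φ ν p.2) ∧
      -- the projective tensor product of `ker β` (with its own projective norm) and `F(ℝ)`
      (∃ Ψ : LipFreeTensor.ProjTensor LipFreeTensor.kerBeta (LipFreeTensor.LipFree ℝ)
          ≃ₗᵢ[ℝ] LipFreeTensor.zeroFstIntegral,
        ∀ (κ : LipFreeTensor.kerBeta) (ν : LipFreeTensor.LipFree ℝ),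
          (Ψ (LipFreeTensor.ptmul κ ν) : LipFreeTensor.L1Plane) =
            Φ (LipFreeTensor.ptmul (κ : LipFreeTensor.LipFree ℝ) ν)) ∧
      -- the same space, as a subspace of the projective tensor product of `F(ℝ)` with itself
      (∀ ξ, ξ ∈ LipFreeTensor.closedSpanTensors LipFreeTensor.kerBeta ⊤ ↔
        Φ ξ ∈ LipFreeTensor.zeroFstIntegral) ∧
      -- the symmetric statements
      (∃ Ψ : LipFreeTensor.ProjTensor (LipFreeTensor.LipFree ℝ) LipFreeTensor.kerBeta
          ≃ₗᵢ[ℝ] LipFreeTensor.zeroSndIntegral,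
        ∀ (μ : LipFreeTensor.LipFree ℝ) (κ : LipFreeTensor.kerBeta),
          (Ψ (LipFreeTensor.ptmul μ κ) : LipFreeTensor.L1Plane) =
            Φ (LipFreeTensor.ptmul μ (κ : LipFreeTensor.LipFree ℝ))) ∧
      (∀ ξ, ξ ∈ LipFreeTensor.closedSpanTensors ⊤ LipFreeTensor.kerBeta ↔
        Φ ξ ∈ LipFreeTensor.zeroSndIntegral) := by
  obtain ⟨Φ, hΦ⟩ := exists_plane_equiv
  obtain ⟨Ψ₁, hΨ₁⟩ := exists_zeroFstIntegral_equiv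
  obtain ⟨Ψ₂, hΨ₂⟩ := exists_zeroSndIntegral_equiv
  refine ⟨lipFreeEquiv, Φ, fun x => ?_, fun μ ν => ?_,
    ⟨Ψ₁, fun κ ν => (hΨ₁ κ ν).trans (hΦ _ _).symm⟩, mem_closedSpanTensors_iff Φ ?_,
    ⟨Ψ₂, fun μ κ => (hΨ₂ μ κ).trans (hΦ _ _).symm⟩, mem_closedSpanTensors_iff Φ ?_⟩
  · rw [lipFreeEquiv_delta]
    exact coeFn_signedInterval x
  · rw [hΦ]
    exact coeFn_mulProd _ _
  · simp only [hΦ]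
    exact zeroFstIntegral_eq_closure_kerBeta
  · simp only [hΦ]
    exact zeroSndIntegral_eq_closure_kerBeta
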